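/- Let $\mathcal H$ be a complex Hilbert space, let $A,B\in\mathcal B(\mathcal H)$ be strictly positive (that is, positive and invertible) operators, and let $\Phi:\mathcal B(\mathcal H)\to\mathcal B(\mathcal H)$ be a positive linear map which is normalized, $\Phi(I)=I$. For strictly positive $X,Y$ and $v\in[0,1]$ write $X\nabla_v Y=(1-v)X+vY$ and $X\sharp_v Y=X^{1/2}\left(X^{-1/2}YX^{-1/2}\right)^vX^{1/2}$. Let $f:(0,\infty)\to(0,\infty)$ be operator monotone decreasing, i.e. $f$ is continuous and $f(Y)\le f(X)$ for all self-adjoint operators $X\le Y$ with spectra in $(0,\infty)$ on every complex Hilbert space. Then for every $v\in[0,1]$ $$f(\Phi(A\nabla_v B))\le f(\Phi(A))\,\sharp_v\, f(\Phi(B))\le \Phi(f(A))\,\nabla_v\,\Phi(f(B)),$$ $$f(\Phi(A\nabla_v B))\le \Phi\big(f(A)\,\sharp_v\, f(B)\big)\le \Phi(f(A))\,\nabla_v\,\Phi(f(B)),$$ and, more precisely, $$f(\Phi(A\nabla_v B))\le f(\Phi(A))\,\sharp_v\, f(\Phi(B))\le \Phi\big(f(A)\,\sharp_v\, f(B)\big)\le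 \Phi(f(A))\,\nabla_v\,\Phi(f(B)).$$ -/

import Mathlib

open Set

universe u

noncomputable section

/-- The weighted arithmetic mean `A ∇_v B = (1 - v) A + v B` of two operators. -/
def opArithMean {H : Type*} [NormedAddCommGroup H] [InnerProductSpace ℂ H] [CompleteSpace H]
    (v : ℝ) (A B : H →L[ℂ] H) : H →L[ℂ] H :=
  (1 - v) • A + v • B

/-- The weighted geometric mean
`A ♯_v B = A^(1/2) (A^(-1/2) B A^(-1/2))^v A^(1/2)`, meant for strictly positive (that is, positive
and invertible) operators; real powers are those of the continuous functional calculus. -/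
def opGeomMean {H : Type*} [NormedAddCommGroup H] [InnerProductSpace ℂ H] [CompleteSpace H]
    (v : ℝ) (A B : H →L[ℂ] H) : H →L[ℂ] H :=
  A ^ (1 / 2 : ℝ) * (A ^ (-(1 / 2) : ℝ) * B * A ^ (-(1 / 2) : ℝ)) ^ v * A ^ (1 / 2 : ℝ)

/-- `f` is operator monotone decreasing on the interval `J`: it is continuous on `J`, and for
self-adjoint operators `A ≤ B` with spectra in `J`, acting on an arbitrary complex Hilbert space,
`f(B) ≤ f(A)`. Here `≤` is the Loewner order and `f(A)` is the continuous functional calculus. -/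
def OperatorMonotoneDecreasingOn (J : Set ℝ) (f : ℝ → ℝ) : Prop :=
  ContinuousOn f J ∧
    ∀ (K : Type u) [NormedAddCommGroup K] [InnerProductSpace ℂ K] [CompleteSpace K]
      (A B : K →L[ℂ] K), IsSelfAdjoint A → IsSelfAdjoint B →
      spectrum ℝ A ⊆ J → spectrum ℝ B ⊆ J → A ≤ B → cfc f B ≤ cfc f A

end

/-!
# Jensen-type inequalities for operator monotone decreasing functions and geometric means

The argument rests on Jensen's operator inequality. If `D` is positive and `V` an isometry, then `D`
is dominated by `V (V*DV + ε) V* + M (1 - VV*)` for `M` large, and an operator monotone decreasing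
function `f` turns this into `f(V*DV) ≤ V* f(D) V`
(`OperatorMonotoneDecreasingOn.cfc_compression_le`). Direct sums give the inequality for operator
convex combinations, and continuous partitions of unity give `f(Φ(X)) ≤ Φ(f(X))` for every positive
unital map `Φ` (`OperatorMonotoneDecreasingOn.cfc_map_le_map_cfc`). Positivity of `f` plays no role
here, so the result also applies to `-1/f` and to `t ↦ -t ^ v`; the latter yields Ando's inequality
`Φ(X ♯ᵥ Y) ≤ Φ(X) ♯ᵥ Φ(Y)`.

Put `g = 1/f`, which is operator monotone increasing, hence operator concave. The geometric mean
commutes with inversion and lies below the arithmetic mean, so `g(X) ♯ᵥ g(Y) ≤ g(X ∇ᵥ Y)`, which is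
the log-convexity `f(X ∇ᵥ Y) ≤ f(X) ♯ᵥ f(Y)`; with `X = Φ(A)` and `Y = Φ(B)` this is the leftmost
inequality. For the middle one,
`Φ(f(A) ♯ᵥ f(B)) = Φ((g(A) ♯ᵥ g(B))⁻¹) ≥ Φ(g(A) ♯ᵥ g(B))⁻¹ ≥ (Φ(g(A)) ♯ᵥ Φ(g(B)))⁻¹
  ≥ (g(Φ(A)) ♯ᵥ g(Φ(B)))⁻¹ = f(Φ(A)) ♯ᵥ f(Φ(B))`
by the inequalities of Choi, Ando and Jensen and the monotonicity of `♯ᵥ`. The rightmost one is the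
arithmetic–geometric mean inequality under `Φ`. The remaining inequalities follow by transitivity.
-/

open Filter Topology ContinuousLinearMap
open scoped InnerProduct

/-! ### Intertwining operators and the functional calculus -/

/-- An operator intertwining `A` and `D` intertwines `f(A)` and `f(D)`: this is clear for polynomials,
and they are uniformly dense on the union of the two spectra. This is how functions of block
operators are computed below, without identifying the algebra they generate. -/
theorem cfc_comp_eq_comp_cfc_of_comp_eq {H K : Type*}
    [NormedAddCommGroup H] [InnerProductSpace ℂ H] [CompleteSpace H]
    [NormedAddCommGroup K] [InnerProductSpace ℂ K] [CompleteSpace K]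
    {A : H →L[ℂ] H} {D : K →L[ℂ] K} (hA : IsSelfAdjoint A) (hD : IsSelfAdjoint D)
    {S : H →L[ℂ] K} (h : D ∘L S = S ∘L A) {f : ℝ → ℝ}
    (hfA : ContinuousOn f (spectrum ℝ A)) (hfD : ContinuousOn f (spectrum ℝ D)) :
    cfc f D ∘L S = S ∘L cfc f A := by
  have hpoly (p : Polynomial ℝ) : cfc p.eval D ∘L S = S ∘L cfc p.eval A := by
    rw [cfc_polynomial p D, cfc_polynomial p A]
    induction p using Polynomial.induction_on' with
    | add p q hp hq => simp [map_add, add_comp, comp_add, hp, hq]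
    | monomial n a =>
      have hn : (D ^ n) ∘L S = S ∘L (A ^ n) := by
        induction n with
        | zero => ext; simp
        | succ n ih =>
          rw [pow_succ, pow_succ', mul_def, mul_def, comp_assoc, h, ← comp_assoc, ih, comp_assoc]
          rw [← mul_def, ← mul_def, ← pow_succ, ← pow_succ']
      ext x
      have := congr($hn x)
      simp only [comp_apply] at this
      simp [Polynomial.aeval_monomial, Algebra.algebraMap_eq_smul_one, this]
  have hcA : IsCompact (spectrum ℝ A) := isCompact_iff_compactSpace.mpr inferInstance
  have hcD : IsCompact (spectrum ℝ D) := isCompact_iff_compactSpace.mpr inferInstance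
  set s := spectrum ℝ A ∪ spectrum ℝ D with hs
  have hcs : IsCompact s := hcA.union hcD
  have : CompactSpace s := isCompact_iff_compactSpace.mp hcs
  have hf : ContinuousOn f s := hfA.union_of_isClosed hfD hcA.isClosed hcD.isClosed
  rw [← sub_eq_zero, ← norm_le_zero_iff]
  refine le_of_forall_pos_le_add fun ε hε ↦ ?_
  obtain ⟨δ, hδ, hδε⟩ : ∃ δ > 0, 2 * δ * ‖S‖ ≤ ε := by
    refine ⟨ε / (2 * (‖S‖ + 1)), by positivity, ?_⟩
    field_simp
    linarith
  obtain ⟨p, hp⟩ : ∃ p : Polynomial ℝ, ∀ x ∈ s, |f x - p.eval x| ≤ δ := by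
    have hmem : (⟨s.domRestrict f, hf.domRestrict⟩ : C(s, ℝ)) ∈
        (polynomialFunctions s).topologicalClosure := by
      rw [polynomialFunctions.topologicalClosure]; trivial
    rw [← SetLike.mem_coe, Subalgebra.topologicalClosure_coe, Metric.mem_closure_iff] at hmem
    obtain ⟨_, ⟨p, -, rfl⟩, hp⟩ := hmem δ hδ
    refine ⟨p, fun x hx ↦ ?_⟩
    have := (ContinuousMap.dist_apply_le_dist (x := ⟨x, hx⟩)).trans hp.le
    rwa [Real.dist_eq] at this
  have hD' : ‖cfc f D - cfc p.eval D‖ ≤ δ := by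
    rw [← cfc_sub ..]
    exact norm_cfc_le hδ.le fun x hx ↦ hp x (.inr hx)
  have hA' : ‖cfc f A - cfc p.eval A‖ ≤ δ := by
    rw [← cfc_sub ..]
    exact norm_cfc_le hδ.le fun x hx ↦ hp x (.inl hx)
  calc ‖cfc f D ∘L S - S ∘L cfc f A‖
      = ‖(cfc f D - cfc p.eval D) ∘L S - S ∘L (cfc f A - cfc p.eval A)‖ := by
        rw [sub_comp, comp_sub, hpoly]; congr 1; abel
    _ ≤ δ * ‖S‖ + ‖S‖ * δ := by
        refine (norm_sub_le _ _).trans (add_le_add ?_ ?_)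
        · exact (opNorm_comp_le _ _).trans (by gcongr)
        · exact (opNorm_comp_le _ _).trans (by gcongr)
    _ ≤ 0 + ε := by linarith

/-! ### Compressions -/

/-- Up to a small multiple of `p` and a large multiple of `1 - p`, a self-adjoint element is
dominated by its compression to `p`: the off-diagonal blocks are absorbed by the diagonal ones. -/
theorem IsStarProjection.exists_le_compression_add {A : Type*} [CStarAlgebra A] [PartialOrder A]
    [StarOrderedRing A] {p : A} (hp : IsStarProjection p) {d : A} (hd : IsSelfAdjoint d)
    {ε : ℝ} (hε : 0 < ε) :
    ∃ M : ℝ, d ≤ p * d * p + ε • p + M • (1 - p) := by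
  set q := 1 - p with hq
  have hpp : p * p = p := hp.isIdempotentElem
  have hps : star p = p := hp.isSelfAdjoint
  have hqs : star q = q := by simp [hq, hps]
  have hqq : q * q = q := by simp [hq, mul_sub, sub_mul, hpp]
  have hds : star d = d := hd
  set e := d + ε⁻¹ • (d * d) with he
  have hes : IsSelfAdjoint e := by simp [he, isSelfAdjoint_iff, hds]
  refine ⟨‖e‖, ?_⟩
  -- The square of `ε p - d q` dominates the off-diagonal blocks of `d`, at the cost of `ε p` and of
  -- `ε⁻¹ q d² q`; the latter and `q d q` are bounded by `‖e‖ q`.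
  have h1 : 0 ≤ ε⁻¹ • (star (ε • p - d * q) * (ε • p - d * q)) :=
    smul_nonneg (by positivity) (star_mul_self_nonneg _)
  have h2 : 0 ≤ star q * (algebraMap ℝ A ‖e‖ - e) * q :=
    star_left_conjugate_nonneg (sub_nonneg.mpr hes.le_algebraMap_norm_self) _
  have hsplit : d = p * d * p + p * d * q + q * d * p + q * d * q := by
    simp only [hq]; noncomm_ring
  rw [← sub_nonneg]
  convert add_nonneg h1 h2 using 1
  have e1 : ε⁻¹ • (star (ε • p - d * q) * (ε • p - d * q)) =
      ε • p - p * d * q - q * d * p + ε⁻¹ • (q * (d * d) * q) := by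
    have : star (ε • p - d * q) = ε • p - q * d := by simp [hps, hqs, hds]
    rw [this]
    simp only [mul_sub, sub_mul, smul_mul_assoc, mul_smul_comm, hpp, smul_sub, smul_smul,
      inv_mul_cancel₀ hε.ne', one_smul, mul_assoc]
    simp only [inv_mul_cancel_left₀ hε.ne']
    abel
  have e2 : star q * (algebraMap ℝ A ‖e‖ - e) * q =
      ‖e‖ • q - q * d * q - ε⁻¹ • (q * (d * d) * q) := by
    rw [hqs, he, Algebra.algebraMap_eq_smul_one]
    simp only [mul_sub, sub_mul, mul_add, add_mul, smul_mul_assoc, mul_smul_comm, mul_one, hqq,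
      mul_assoc]
    abel
  rw [e1, e2]
  linear_combination (norm := abel) -hsplit

theorem IsStrictlyPositive.exists_pos_algebraMap_le {A : Type*} [CStarAlgebra A] [PartialOrder A]
    [StarOrderedRing A] {a : A} (ha : IsStrictlyPositive a) :
    ∃ r : ℝ, 0 < r ∧ algebraMap ℝ A r ≤ a := by
  rcases subsingleton_or_nontrivial A with _ | _
  · exact ⟨1, one_pos, (Subsingleton.elim _ _).le⟩
  exact (CFC.exists_pos_algebraMap_le_iff ha.isSelfAdjoint).2 fun x hx ↦ ha.spectrum_pos hx

theorem IsStrictlyPositive.spectrum_subset_Ioi {A : Type*} [CStarAlgebra A] [PartialOrder A]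
    [StarOrderedRing A] {a : A} (ha : IsStrictlyPositive a) : spectrum ℝ a ⊆ Ioi 0 :=
  fun _ hx ↦ ha.spectrum_pos hx

/-- Continuity of `f(a + ε)` at `ε = 0⁺`; the spectra stay in one compact subset of `(0, ∞)`. -/
theorem tendsto_cfc_add_smul_one {A : Type*} [CStarAlgebra A] [PartialOrder A]
    [StarOrderedRing A] {a : A} (ha : IsStrictlyPositive a) {f : ℝ → ℝ}
    (hf : ContinuousOn f (Ioi 0)) :
    Tendsto (fun ε : ℝ ↦ cfc f (a + ε • (1 : A))) (𝓝[>] 0) (𝓝 (cfc f a)) := by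
  obtain ⟨r, hr, hra⟩ := ha.exists_pos_algebraMap_le
  have hsa (ε : ℝ) : IsSelfAdjoint (a + ε • (1 : A)) :=
    ha.isSelfAdjoint.add ((IsSelfAdjoint.all ε).smul (.one A))
  have key (ε : ℝ) (h0 : 0 ≤ ε) (h1 : ε ≤ 1) :
      spectrum ℝ (a + ε • (1 : A)) ⊆ Icc r (‖a‖ + 1) := by
    have hl : algebraMap ℝ A r ≤ a + ε • 1 :=
      hra.trans (le_add_of_nonneg_right (smul_nonneg h0 zero_le_one))
    have hu : a + ε • 1 ≤ algebraMap ℝ A (‖a‖ + 1) := by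
      rw [map_add, Algebra.algebraMap_eq_smul_one (1 : ℝ)]
      gcongr
      exact ha.isSelfAdjoint.le_algebraMap_norm_self
    exact fun x hx ↦ ⟨(algebraMap_le_iff_le_spectrum (hsa ε)).1 hl x hx,
      (le_algebraMap_iff_spectrum_le (hsa ε)).1 hu x hx⟩
  refine Filter.Tendsto.cfc (s := Icc r (‖a‖ + 1)) isCompact_Icc f ?_ ?_ (.of_forall hsa) ?_
    ha.isSelfAdjoint (hf.mono fun x hx ↦ hr.trans_le hx.1)
  · have : Continuous fun ε : ℝ ↦ a + ε • (1 : A) := by fun_prop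
    simpa using (this.tendsto 0).mono_left nhdsWithin_le_nhds
  · filter_upwards [Ioc_mem_nhdsGT one_pos] with ε hε using key ε hε.1.le hε.2
  · simpa using key 0 le_rfl zero_le_one

/-- Jensen's inequality for compressions (Hansen–Pedersen): `f(V*DV) ≤ V* f(D) V` for an isometry
`V`. The operator `D` is dominated by a block diagonal operator whose block on the range of `V` is
`V*DV + ε`; apply `f` to both sides, compress with `V`, and let `ε → 0`. -/
theorem OperatorMonotoneDecreasingOn.cfc_compression_le {H K : Type u}
    [NormedAddCommGroup H] [InnerProductSpace ℂ H] [CompleteSpace H]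
    [NormedAddCommGroup K] [InnerProductSpace ℂ K] [CompleteSpace K] {f : ℝ → ℝ}
    (hf : OperatorMonotoneDecreasingOn.{u} (Ioi 0) f)
    {V : H →L[ℂ] K} (hV : V† ∘L V = 1) {D : K →L[ℂ] K} (hD : IsStrictlyPositive D) :
    cfc f (V† ∘L D ∘L V) ≤ V† ∘L cfc f D ∘L V := by
  have hconj {S T : K →L[ℂ] K} (h : S ≤ T) : V† ∘L S ∘L V ≤ V† ∘L T ∘L V := by
    rw [ContinuousLinearMap.le_def] at h ⊢
    convert h.adjoint_conj V using 1
    simp [comp_sub, sub_comp]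
  obtain ⟨r, hr, hrD⟩ := hD.exists_pos_algebraMap_le
  set X := V† ∘L D ∘L V with hX
  have hXpos : IsStrictlyPositive X := by
    refine .of_le (isStrictlyPositive_algebraMap hr) (?_ : algebraMap ℝ (H →L[ℂ] H) r ≤ X)
    convert hconj hrD using 1
    simp [Algebra.algebraMap_eq_smul_one, ← hV, one_def, smul_comp]
  refine le_of_tendsto (tendsto_cfc_add_smul_one hXpos hf.1) ?_
  filter_upwards [self_mem_nhdsWithin] with ε (hε : 0 < ε)
  set P : K →L[ℂ] K := V ∘L V† with hP
  have hPV : P ∘L V = V := by rw [hP, comp_assoc, hV, one_def, comp_id]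
  have hPproj : IsStarProjection P := by
    refine ⟨?_, ?_⟩
    · rw [IsIdempotentElem, mul_def]
      nth_rw 2 [hP]
      rw [← comp_assoc, hPV]
    · simp [hP, isSelfAdjoint_iff, star_eq_adjoint, adjoint_comp]
  obtain ⟨M, hM⟩ := hPproj.exists_le_compression_add hD.isSelfAdjoint hε
  set R : K →L[ℂ] K := P * D * P + ε • P + M • (1 - P) with hR
  have hRpos : IsStrictlyPositive R := .of_le hD hM
  have hXε : IsStrictlyPositive (X + ε • (1 : H →L[ℂ] H)) :=
    hXpos.add_nonneg (smul_nonneg hε.le zero_le_one)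
  have hRV : R ∘L V = V ∘L (X + ε • 1) := by
    have h1 : (P * D * P) ∘L V = V ∘L X := by
      rw [mul_def, mul_def, comp_assoc, hPV, comp_assoc, hP, comp_assoc]
    have h2 : (1 - P) ∘L V = 0 := by rw [sub_comp, hPV, one_def, id_comp, sub_self]
    rw [hR, add_comp, add_comp, smul_comp, smul_comp, h1, h2, hPV, comp_add]
    simp [one_def]
  have hcfc := cfc_comp_eq_comp_cfc_of_comp_eq hXε.isSelfAdjoint hRpos.isSelfAdjoint hRV
    (hf.1.mono hXε.spectrum_subset_Ioi) (hf.1.mono hRpos.spectrum_subset_Ioi)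
  have hmono := hconj (hf.2 K D R hD.isSelfAdjoint hRpos.isSelfAdjoint hD.spectrum_subset_Ioi
    hRpos.spectrum_subset_Ioi hM)
  rwa [hcfc, ← comp_assoc, hV, one_def, id_comp] at hmono

/-! ### Operator Jensen inequality for finite families -/

/-- Jensen's inequality for operator convex combinations. It is the inequality for compressions
applied to the isometry `x ↦ (Tᵢ x)ᵢ` into `⨁ᵢ H` and the diagonal operator with entries `Aᵢ`. The
index type lives in `Type` so that the direct sum stays in the universe of `H`. -/
theorem OperatorMonotoneDecreasingOn.cfc_sum_conj_le {H : Type u} {ι : Type} [Fintype ι]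
    [NormedAddCommGroup H] [InnerProductSpace ℂ H] [CompleteSpace H] {f : ℝ → ℝ}
    (hf : OperatorMonotoneDecreasingOn.{u} (Ioi 0) f)
    {T A : ι → H →L[ℂ] H} (hT : ∑ i, star (T i) * T i = 1) (hA : ∀ i, IsStrictlyPositive (A i)) :
    cfc f (∑ i, star (T i) * A i * T i) ≤ ∑ i, star (T i) * cfc f (A i) * T i := by
  classical
  -- `π i` is the `i`-th coordinate projection of the Hilbert sum; its adjoint is the `i`-th inclusion.
  let π (i : ι) : PiLp 2 (fun _ : ι ↦ H) →L[ℂ] H := PiLp.proj 2 (fun _ : ι ↦ H) i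
  have hπ' (i : ι) (x : H) : ((π i)†) x = WithLp.toLp 2 (Pi.single i x) := by
    refine ext_inner_right ℂ fun y ↦ ?_
    rw [adjoint_inner_left, PiLp.inner_apply]
    simp only [Pi.single_apply]
    rw [Finset.sum_eq_single i] <;> simp +contextual [π]
  have hππ (i j : ι) : π i ∘L (π j)† = if i = j then 1 else 0 := by
    ext x
    rw [comp_apply, hπ']
    split_ifs with h <;> simp [π, h]
  have hsum : ∑ i, (π i)† ∘L π i = 1 := by
    ext x i
    simp [hπ', π, sum_apply]
  set V := ∑ i, (π i)† ∘L T i with hVdef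
  set D := ∑ i, (π i)† ∘L A i ∘L π i with hDdef
  have hπV (i : ι) : π i ∘L V = T i := by
    simp only [hVdef, comp_finsetSum, ← comp_assoc, hππ]
    rw [Finset.sum_eq_single i] <;> simp +contextual [one_def, eq_comm]
  have hVadj : V† = ∑ i, star (T i) ∘L π i := by
    simp [hVdef, map_sum, adjoint_comp, star_eq_adjoint]
  have hVV : V† ∘L V = 1 := by
    simp only [hVadj, finsetSum_comp, comp_assoc, hπV]
    simpa [mul_def] using hT
  have hDπ (i : ι) : D ∘L (π i)† = (π i)† ∘L A i := by
    simp only [hDdef, finsetSum_comp, comp_assoc, hππ]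
    rw [Finset.sum_eq_single i] <;> simp +contextual [one_def]
  have hDpos : IsStrictlyPositive D := by
    have hmul (B C : ι → H →L[ℂ] H) (hBC : ∀ i, B i * C i = 1) :
        (∑ i, (π i)† ∘L B i ∘L π i) * (∑ i, (π i)† ∘L C i ∘L π i) = 1 := by
      rw [← hsum, mul_def, comp_finsetSum]
      refine Finset.sum_congr rfl fun i _ ↦ ?_
      simp only [← comp_assoc, finsetSum_comp]
      simp only [comp_assoc _ (π _) _, hππ]
      rw [Finset.sum_eq_single i, if_pos rfl, one_def, comp_id, comp_assoc ((π i)†), ← mul_def,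
        hBC, one_def, comp_id]
      all_goals simp +contextual
    refine IsUnit.isStrictlyPositive ?_ (Finset.sum_nonneg fun i _ ↦ ?_)
    · exact isUnit_iff_exists.2 ⟨∑ i, (π i)† ∘L Ring.inverse (A i) ∘L π i,
        hmul _ _ fun i ↦ Ring.mul_inverse_cancel _ (hA i).isUnit,
        hmul _ _ fun i ↦ Ring.inverse_mul_cancel _ (hA i).isUnit⟩
    · exact (nonneg_iff_isPositive _).2 (((nonneg_iff_isPositive _).1 (hA i).nonneg).adjoint_conj _)
  have hfDV : cfc f D ∘L V = ∑ i, (π i)† ∘L cfc f (A i) ∘L T i := by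
    simp only [hVdef, comp_finsetSum, ← comp_assoc]
    refine Finset.sum_congr rfl fun i _ ↦ ?_
    rw [cfc_comp_eq_comp_cfc_of_comp_eq (hA i).isSelfAdjoint hDpos.isSelfAdjoint (hDπ i)
      (hf.1.mono (hA i).spectrum_subset_Ioi) (hf.1.mono hDpos.spectrum_subset_Ioi)]
  have hDV : D ∘L V = ∑ i, (π i)† ∘L A i ∘L T i := by
    simp only [hDdef, finsetSum_comp, comp_assoc, hπV]
  have hVπ (i : ι) : V† ∘L (π i)† = star (T i) := by
    rw [← adjoint_comp, hπV, star_eq_adjoint]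
  have h1 := hf.cfc_compression_le hVV hDpos
  rw [hfDV, hDV, comp_finsetSum, comp_finsetSum] at h1
  simp only [← comp_assoc, hVπ] at h1
  simpa only [mul_def] using h1

/-! ### Jensen's operator inequality for positive unital maps -/

/-- A continuous partition of unity on `[m, M]` (rescaled Bernstein polynomials) with nodes `c k`
that reproduces `x ↦ x` exactly and approximates `f` uniformly. -/
theorem exists_partition_approx {f : ℝ → ℝ} {m M : ℝ} (hmM : m < M)
    (hf : ContinuousOn f (Icc m M)) {δ : ℝ} (hδ : 0 < δ) :
    ∃ (n : ℕ) (c : Fin n → ℝ) (φ : Fin n → ℝ → ℝ), (∀ k, c k ∈ Icc m M) ∧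
      (∀ k, Continuous (φ k)) ∧ ∀ x ∈ Icc m M, (∀ k, 0 ≤ φ k x) ∧ ∑ k, φ k x = 1 ∧
        ∑ k, c k * φ k x = x ∧ |∑ k, f (c k) * φ k x - f x| ≤ δ := by
  have hd : 0 < M - m := sub_pos.2 hmM
  have hmaps (t : unitInterval) : m + (M - m) * t ∈ Icc m M :=
    ⟨by nlinarith [t.2.1], by nlinarith [t.2.2]⟩
  let g : C(unitInterval, ℝ) :=
    ⟨fun t ↦ f (m + (M - m) * t), hf.comp_continuous (by fun_prop) hmaps⟩
  obtain ⟨n, hn, hn1⟩ := ((Metric.tendsto_nhds.1 (bernsteinApproximation_uniform g) δ hδ).and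
    (eventually_ge_atTop 1)).exists
  have hn0 : (n : ℝ) ≠ 0 := by positivity
  refine ⟨n + 1, fun k ↦ m + (M - m) * (bernstein.z k : unitInterval),
    fun k x ↦ (bernsteinPolynomial ℝ n k).eval ((x - m) / (M - m)), fun k ↦ hmaps _,
    fun k ↦ by fun_prop, fun x hx ↦ ?_⟩
  let t : unitInterval := ⟨(x - m) / (M - m), div_nonneg (sub_nonneg.2 hx.1) hd.le,
    (div_le_one hd).2 (by linarith [hx.2])⟩
  have hxt : m + (M - m) * t = x := by simp only [t]; field_simp; ring
  have hφ (k : Fin (n + 1)) :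
      (bernsteinPolynomial ℝ n k).eval ((x - m) / (M - m)) = bernstein n k t := rfl
  have h1 : ∑ k : Fin (n + 1), bernstein n k t = 1 := bernstein.probability n t
  have hlin : ∑ k : Fin (n + 1), ((bernstein.z k : unitInterval) : ℝ) * bernstein n k t = t := by
    have := congr(Polynomial.eval (t : ℝ) $(bernsteinPolynomial.sum_smul ℝ n))
    rw [Polynomial.eval_finsetSum, Finset.sum_range] at this
    simp only [nsmul_eq_mul, Polynomial.eval_mul, Polynomial.eval_natCast, Polynomial.eval_X]
      at this
    rw [← mul_right_inj' hn0, ← this, Finset.mul_sum]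
    refine Finset.sum_congr rfl fun k _ ↦ ?_
    simp only [bernstein.z, ← mul_assoc]
    rw [mul_div_cancel₀ _ hn0]
    rfl
  simp only [hφ]
  refine ⟨fun k ↦ bernstein_nonneg, h1, ?_, ?_⟩
  · simp only [add_mul, Finset.sum_add_distrib, mul_assoc, ← Finset.mul_sum, h1, hlin, mul_one]
    exact hxt
  · have := (ContinuousMap.dist_apply_le_dist (x := t)).trans hn.le
    rw [bernsteinApproximation.apply, Real.dist_eq] at this
    simpa [g, hxt, mul_comm] using this

theorem PositiveLinearMap.map_smul_real {A B : Type*} [CStarAlgebra A] [PartialOrder A]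
    [CStarAlgebra B] [PartialOrder B] (Φ : A →ₚ[ℂ] B) (r : ℝ) (a : A) : Φ (r • a) = r • Φ a := by
  rw [← Complex.coe_smul, map_smul, Complex.coe_smul]

/-- The Choi–Davis–Jensen inequality `f(Φ(X)) ≤ Φ(f(X))` for a positive unital map. With
`Eₖ = Φ(φₖ(X))` for a partition of unity `φₖ` with nodes `cₖ` one has `Φ(X) = ∑ cₖ Eₖ` and
`Φ(f(X)) ≈ ∑ f(cₖ) Eₖ`, so the inequality for operator convex combinations of scalars applies. No
complete positivity is needed, as only the commutative algebra generated by `X` is involved. -/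
theorem OperatorMonotoneDecreasingOn.cfc_map_le_map_cfc {H : Type u} {A : Type*}
    [NormedAddCommGroup H] [InnerProductSpace ℂ H] [CompleteSpace H]
    [CStarAlgebra A] [PartialOrder A] [StarOrderedRing A] {f : ℝ → ℝ}
    (hf : OperatorMonotoneDecreasingOn.{u} (Ioi 0) f)
    (Φ : A →ₚ[ℂ] (H →L[ℂ] H)) (hΦ : Φ 1 = 1) {X : A} (hX : IsStrictlyPositive X) :
    cfc f (Φ X) ≤ Φ (cfc f X) := by
  obtain ⟨m, hm, hmX⟩ := hX.exists_pos_algebraMap_le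
  set M := m + ‖X‖ + 1 with hM
  have hmM : m < M := by linarith [norm_nonneg X]
  have hsa := hX.isSelfAdjoint
  have hspec : spectrum ℝ X ⊆ Icc m M := fun x hx ↦
    ⟨(algebraMap_le_iff_le_spectrum hsa).1 hmX x hx,
      ((le_algebraMap_iff_spectrum_le hsa).1 hsa.le_algebraMap_norm_self x hx).trans
        (by linarith)⟩
  have hIcc : Icc m M ⊆ Ioi 0 := fun x hx ↦ hm.trans_le hx.1
  have hsmul := Φ.map_smul_real
  suffices h : ∀ δ > (0 : ℝ), cfc f (Φ X) ≤ Φ (cfc f X) + δ • 1 by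
    have hlim : Tendsto (fun δ : ℝ ↦ Φ (cfc f X) + δ • (1 : H →L[ℂ] H)) (𝓝[>] 0)
        (𝓝 (Φ (cfc f X))) := by
      have : Continuous fun δ : ℝ ↦ Φ (cfc f X) + δ • (1 : H →L[ℂ] H) := by fun_prop
      simpa using (this.tendsto 0).mono_left nhdsWithin_le_nhds
    exact ge_of_tendsto hlim (by filter_upwards [self_mem_nhdsWithin] with δ hδ using h δ hδ)
  intro δ hδ
  obtain ⟨n, c, φ, hc, hφc, hφ⟩ := exists_partition_approx hmM (hf.1.mono hIcc) hδ
  have hcfc (a : Fin n → ℝ) :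
      ∑ k, a k • Φ (cfc (φ k) X) = Φ (cfc (fun x ↦ ∑ k, a k * φ k x) X) := by
    simp only [← hsmul, ← map_sum]
    congr 1
    have hfun : (fun x ↦ ∑ k, a k * φ k x) = ∑ k, fun x ↦ a k * φ k x := by
      ext x; simp
    rw [hfun, cfc_sum_univ (fun k x ↦ a k * φ k x) X
      (fun k ↦ ((hφc k).const_mul _).continuousOn)]
    exact Finset.sum_congr rfl fun k _ ↦ (cfc_const_mul _ _ X (hφc k).continuousOn).symm
  set E : Fin n → H →L[ℂ] H := fun k ↦ Φ (cfc (φ k) X)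
  have hE0 (k) : 0 ≤ E k := Φ.map_nonneg (cfc_nonneg fun x hx ↦ (hφ x (hspec hx)).1 k)
  have hsq (a : ℝ) (k) : star (CFC.sqrt (E k)) * algebraMap ℝ (H →L[ℂ] H) a * CFC.sqrt (E k) =
      a • E k := by
    rw [(CFC.sqrt_nonneg (E k)).isSelfAdjoint.star_eq, Algebra.algebraMap_eq_smul_one]
    simp [CFC.sqrt_mul_sqrt_self (E k) (hE0 k)]
  have hsum : ∑ k, star (CFC.sqrt (E k)) * CFC.sqrt (E k) = 1 := by
    have h1 : ∑ k, (1 : ℝ) • E k = 1 := by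
      rw [hcfc, ← hΦ, ← cfc_one ℝ X]
      exact congrArg Φ (cfc_congr fun x hx ↦ by simpa using (hφ x (hspec hx)).2.1)
    rw [← h1]
    exact Finset.sum_congr rfl fun k _ ↦ by simpa using hsq 1 k
  have key := hf.cfc_sum_conj_le hsum (A := fun k ↦ algebraMap ℝ (H →L[ℂ] H) (c k))
    fun k ↦ isStrictlyPositive_algebraMap (hIcc (hc k))
  simp only [cfc_algebraMap, hsq] at key
  rw [hcfc, hcfc, cfc_congr (g := id) fun x hx ↦ (hφ x (hspec hx)).2.2.1, cfc_id ℝ X] at key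
  refine key.trans ?_
  have hfX : ContinuousOn f (spectrum ℝ X) := hf.1.mono hX.spectrum_subset_Ioi
  rw [← hΦ, ← hsmul, ← map_add, ← Algebra.algebraMap_eq_smul_one,
    ← cfc_const δ X, ← cfc_add ..]
  refine OrderHomClass.mono Φ (cfc_mono (fun x hx ↦ ?_) (by fun_prop) (by fun_prop))
  linarith [(abs_le.1 (hφ x (hspec hx)).2.2.2).2]

/-! ### Examples of operator monotone decreasing functions -/

theorem IsStrictlyPositive.rpow_neg_one_eq_of_mul_eq_one {A : Type*} [CStarAlgebra A]
    [PartialOrder A] [StarOrderedRing A] {a b : A} (ha : IsStrictlyPositive a) (h : a * b = 1) :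
    a ^ (-1 : ℝ) = b := by
  have h1 : a ^ (-1 : ℝ) * a = 1 := by
    simpa [CFC.rpow_one a ha.nonneg] using CFC.rpow_neg_mul_rpow 1 ha
  exact left_inv_eq_right_inv h1 h

theorem IsStrictlyPositive.rpow_neg_one_rpow_neg_one {A : Type*} [CStarAlgebra A]
    [PartialOrder A] [StarOrderedRing A] {a : A} (ha : IsStrictlyPositive a) :
    (a ^ (-1 : ℝ)) ^ (-1 : ℝ) = a := by
  rw [CFC.rpow_rpow a _ _ (by norm_num) ha]
  simpa using CFC.rpow_one a ha.nonneg

theorem cfc_neg_inv_eq {A : Type*} [CStarAlgebra A] [PartialOrder A] [StarOrderedRing A]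
    {f : ℝ → ℝ} {a : A} (ha : IsSelfAdjoint a) (hf : ContinuousOn f (spectrum ℝ a))
    (hpos : ∀ x ∈ spectrum ℝ a, 0 < f x) :
    cfc (fun t ↦ -(f t)⁻¹) a = -(cfc f a) ^ (-1 : ℝ) := by
  rw [cfc_neg, CFC.cfc_rpow hpos hf ha]
  simp only [Real.rpow_neg_one]

theorem cfc_neg_rpow_eq {A : Type*} [CStarAlgebra A] [PartialOrder A] [StarOrderedRing A]
    {a : A} (ha : 0 ≤ a) (v : ℝ) : cfc (fun t : ℝ ↦ -t ^ v) a = -a ^ v := by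
  rw [cfc_neg, CFC.rpow_eq_cfc_real ha]

theorem operatorMonotoneDecreasingOn_neg_rpow {v : ℝ} (hv : v ∈ Icc (0 : ℝ) 1) :
    OperatorMonotoneDecreasingOn.{u} (Ioi 0) (fun t ↦ -t ^ v) := by
  refine ⟨(continuousOn_id.rpow_const fun x hx ↦ .inl (ne_of_gt hx)).neg,
    fun K _ _ _ A B hA hB hAs hBs hAB ↦ ?_⟩
  have hA' := (StarOrderedRing.isStrictlyPositive_iff_spectrum_pos A hA).2 hAs
  rw [cfc_neg_rpow_eq hA'.nonneg, cfc_neg_rpow_eq (hA'.nonneg.trans hAB)]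
  exact neg_le_neg (CFC.rpow_le_rpow hv hAB)

theorem operatorMonotoneDecreasingOn_inv :
    OperatorMonotoneDecreasingOn.{u} (Ioi 0) (fun t ↦ t ^ (-1 : ℝ)) := by
  refine ⟨continuousOn_id.rpow_const fun x hx ↦ .inl (ne_of_gt hx),
    fun K _ _ _ A B hA hB hAs hBs hAB ↦ ?_⟩
  have hA' := (StarOrderedRing.isStrictlyPositive_iff_spectrum_pos A hA).2 hAs
  rw [← CFC.rpow_eq_cfc_real hA'.nonneg, ← CFC.rpow_eq_cfc_real (hA'.nonneg.trans hAB)]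
  exact CStarAlgebra.rpow_neg_one_le_rpow_neg_one hAB hA'

/-- The reciprocal `1 / f` is operator monotone increasing, stated as a decreasing function so that
Jensen's inequality, which does not require a positive function, applies to it. -/
theorem OperatorMonotoneDecreasingOn.neg_inv {f : ℝ → ℝ}
    (hf : OperatorMonotoneDecreasingOn.{u} (Ioi 0) f) (hpos : ∀ t > 0, 0 < f t) :
    OperatorMonotoneDecreasingOn.{u} (Ioi 0) (fun t ↦ -(f t)⁻¹) := by
  refine ⟨(hf.1.inv₀ fun x hx ↦ (hpos x hx).ne').neg,
    fun K _ _ _ A B hA hB hAs hBs hAB ↦ ?_⟩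
  rw [cfc_neg_inv_eq hA (hf.1.mono hAs) fun x hx ↦ hpos x (hAs hx),
    cfc_neg_inv_eq hB (hf.1.mono hBs) fun x hx ↦ hpos x (hBs hx)]
  refine neg_le_neg (CStarAlgebra.rpow_neg_one_le_rpow_neg_one (hf.2 K A B hA hB hAs hBs hAB) ?_)
  exact (cfc_isStrictlyPositive_iff f B (hf.1.mono hBs) hB).2 fun x hx ↦ hpos x (hBs hx)

/-! ### The weighted geometric mean -/

section GeomMean

variable {H : Type u} [NormedAddCommGroup H] [InnerProductSpace ℂ H] [CompleteSpace H]
  {X Y X' Y' : H →L[ℂ] H} {v : ℝ}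

theorem IsStrictlyPositive.rpow_conj {A : Type*} [CStarAlgebra A] [PartialOrder A]
    [StarOrderedRing A] {a b : A} (ha : IsStrictlyPositive a) (hb : IsStrictlyPositive b) (r : ℝ) :
    IsStrictlyPositive (a ^ r * b * a ^ r) :=
  .conjugate_of_isUnit_of_isSelfAdjoint _ _ (ha.rpow a r).isUnit (ha.rpow a r).isSelfAdjoint hb

theorem IsStrictlyPositive.opGeomMean (hX : IsStrictlyPositive X) (hY : IsStrictlyPositive Y) :
    IsStrictlyPositive (opGeomMean v X Y) :=
  hX.rpow_conj ((hX.rpow_conj hY _).rpow _ v) _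

theorem rpow_half_mul_rpow_half (hX : IsStrictlyPositive X) :
    X ^ (1 / 2 : ℝ) * X ^ (1 / 2 : ℝ) = X := by
  rw [← CFC.rpow_add hX.isUnit]
  norm_num
  exact CFC.rpow_one X hX.nonneg

theorem rpow_half_conj_rpow_neg_half (hX : IsStrictlyPositive X) (Y : H →L[ℂ] H) :
    X ^ (1 / 2 : ℝ) * (X ^ (-(1 / 2) : ℝ) * Y * X ^ (-(1 / 2) : ℝ)) * X ^ (1 / 2 : ℝ) = Y := by
  have h1 := CFC.rpow_mul_rpow_neg (1 / 2) hX
  have h2 := CFC.rpow_neg_mul_rpow (1 / 2) hX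
  rw [mul_assoc, mul_assoc, h2, mul_one, ← mul_assoc, h1, one_mul]

/-- The weighted arithmetic–geometric mean inequality for operators. -/
theorem opGeomMean_le_opArithMean (hX : IsStrictlyPositive X) (hY : IsStrictlyPositive Y)
    (hv : v ∈ Icc (0 : ℝ) 1) : opGeomMean v X Y ≤ opArithMean v X Y := by
  set Z := X ^ (-(1 / 2) : ℝ) * Y * X ^ (-(1 / 2) : ℝ) with hZ
  have hZpos : IsStrictlyPositive Z := hX.rpow_conj hY _
  have h : Z ^ v ≤ (1 - v) • 1 + v • Z := by
    have hlin : (1 - v) • 1 + v • Z = cfc (fun t : ℝ ↦ (1 - v) + v * t) Z := by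
      rw [cfc_const_add .., cfc_const_mul .., cfc_id' ℝ Z, Algebra.algebraMap_eq_smul_one]
    rw [hlin, CFC.rpow_eq_cfc_real hZpos.nonneg]
    refine cfc_mono (fun t ht ↦ ?_) (continuousOn_id.rpow_const fun x hx ↦
      .inl (hZpos.spectrum_pos hx).ne') (by fun_prop)
    have := Real.geom_mean_le_arith_mean2_weighted (sub_nonneg.2 hv.2) hv.1 zero_le_one
      (hZpos.spectrum_pos ht).le (by ring)
    simpa using this
  have h' := (hX.rpow X (1 / 2)).isSelfAdjoint.conjugate_le_conjugate h
  refine h'.trans_eq ?_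
  rw [mul_add, add_mul, mul_smul_comm, mul_smul_comm, smul_mul_assoc, smul_mul_assoc, mul_one,
    rpow_half_mul_rpow_half hX, rpow_half_conj_rpow_neg_half hX, opArithMean]

theorem opGeomMean_le_opGeomMean_right (hX : IsStrictlyPositive X) (hv : v ∈ Icc (0 : ℝ) 1)
    (hYY' : Y ≤ Y') : opGeomMean v X Y ≤ opGeomMean v X Y' :=
  (hX.rpow X (1 / 2)).isSelfAdjoint.conjugate_le_conjugate <| CFC.rpow_le_rpow hv <|
    (hX.rpow X (-(1 / 2))).isSelfAdjoint.conjugate_le_conjugate hYY'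

/-- The mean is symmetric under exchange of its arguments and of the weights. With
`T = Y^(1/2) X^(-1/2)`, the two sides are expressed through `T* T` and `T T*`, which `T`
intertwines. -/
theorem opGeomMean_comm (hX : IsStrictlyPositive X) (hY : IsStrictlyPositive Y) :
    opGeomMean v X Y = opGeomMean (1 - v) Y X := by
  set Z := X ^ (-(1 / 2) : ℝ) * Y * X ^ (-(1 / 2) : ℝ) with hZ
  have hZpos : IsStrictlyPositive Z := hX.rpow_conj hY _
  set U := Y ^ (-(1 / 2) : ℝ) * X * Y ^ (-(1 / 2) : ℝ) with hU
  have hUpos : IsStrictlyPositive U := hY.rpow_conj hX _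
  set T := Y ^ (1 / 2 : ℝ) * X ^ (-(1 / 2) : ℝ) with hT
  have hx1 := CFC.rpow_mul_rpow_neg (1 / 2) hX
  have hx2 := CFC.rpow_neg_mul_rpow (1 / 2) hX
  have hy2 := CFC.rpow_neg_mul_rpow (1 / 2) hY
  have hTX : T * X ^ (1 / 2 : ℝ) = Y ^ (1 / 2 : ℝ) := by
    rw [hT, mul_assoc, hx2, mul_one]
  have hTsT : star T * T = Z := by
    rw [hT, star_mul, (hX.rpow X _).isSelfAdjoint.star_eq, (hY.rpow Y _).isSelfAdjoint.star_eq,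
      mul_assoc, ← mul_assoc (Y ^ _), rpow_half_mul_rpow_half hY, hZ, mul_assoc]
  have hUTT : U * (T * star T) = 1 := by
    have hXX : X * (X ^ (-(1 / 2) : ℝ) * X ^ (-(1 / 2) : ℝ)) = 1 := by
      nth_rw 1 [← rpow_half_mul_rpow_half hX]
      rw [mul_assoc, ← mul_assoc _ (X ^ (-(1 / 2) : ℝ)), hx1, one_mul, hx1]
    calc U * (T * star T)
        = Y ^ (-(1 / 2) : ℝ) * X * (Y ^ (-(1 / 2) : ℝ) * Y ^ (1 / 2 : ℝ)) *
            (X ^ (-(1 / 2) : ℝ) * X ^ (-(1 / 2) : ℝ)) * Y ^ (1 / 2 : ℝ) := by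
          rw [hT, star_mul, (hX.rpow X _).isSelfAdjoint.star_eq,
            (hY.rpow Y _).isSelfAdjoint.star_eq, hU]
          simp only [mul_assoc]
      _ = Y ^ (-(1 / 2) : ℝ) * (X * (X ^ (-(1 / 2) : ℝ) * X ^ (-(1 / 2) : ℝ))) *
            Y ^ (1 / 2 : ℝ) := by
          rw [hy2, mul_one]; simp only [mul_assoc]
      _ = 1 := by rw [hXX, mul_one, hy2]
  have hW : T * star T = U ^ (-1 : ℝ) := (hUpos.rpow_neg_one_eq_of_mul_eq_one hUTT).symm
  have hWpos : IsStrictlyPositive (T * star T) := hW ▸ hUpos.rpow U _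
  have hcont {S : H →L[ℂ] H} (hS : IsStrictlyPositive S) :
      ContinuousOn (fun t : ℝ ↦ t ^ (v - 1)) (spectrum ℝ S) :=
    continuousOn_id.rpow_const fun x hx ↦ .inl (hS.spectrum_pos hx).ne'
  have hint : (T * star T) ^ (v - 1) * T = T * Z ^ (v - 1) := by
    rw [CFC.rpow_eq_cfc_real hWpos.nonneg, CFC.rpow_eq_cfc_real hZpos.nonneg]
    exact cfc_comp_eq_comp_cfc_of_comp_eq hZpos.isSelfAdjoint hWpos.isSelfAdjoint
      (by rw [← hTsT, ← mul_def, ← mul_def, mul_assoc]) (hcont hZpos) (hcont hWpos)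
  have hUW : U ^ (1 - v) = (T * star T) ^ (v - 1) := by
    rw [hW, CFC.rpow_rpow U _ _ (by norm_num) hUpos]
    congr 1; ring
  have hXs : X ^ (1 / 2 : ℝ) * star T = Y ^ (1 / 2 : ℝ) := by
    simpa only [star_mul, (hX.rpow X _).isSelfAdjoint.star_eq,
      (hY.rpow Y _).isSelfAdjoint.star_eq] using congr(star $hTX)
  calc opGeomMean v X Y = X ^ (1 / 2 : ℝ) * (Z * Z ^ (v - 1)) * X ^ (1 / 2 : ℝ) := by
        have hZv : Z * Z ^ (v - 1) = Z ^ v := by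
          have := CFC.rpow_add (x := 1) (y := v - 1) hZpos.isUnit
          rw [CFC.rpow_one Z hZpos.nonneg, add_sub_cancel] at this
          exact this.symm
        rw [hZv, opGeomMean]
    _ = (X ^ (1 / 2 : ℝ) * star T) * (T * Z ^ (v - 1)) * X ^ (1 / 2 : ℝ) := by
        rw [← hTsT]; simp only [mul_assoc]
    _ = Y ^ (1 / 2 : ℝ) * U ^ (1 - v) * Y ^ (1 / 2 : ℝ) := by
        rw [hXs, ← hint, hUW]
        nth_rw 3 [← hTX]
        simp only [mul_assoc]
    _ = opGeomMean (1 - v) Y X := rfl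

theorem opGeomMean_mono (hX : IsStrictlyPositive X) (hY : IsStrictlyPositive Y)
    (hv : v ∈ Icc (0 : ℝ) 1) (hXX' : X ≤ X') (hYY' : Y ≤ Y') :
    opGeomMean v X Y ≤ opGeomMean v X' Y' := by
  have hX' := hX.of_le hXX'
  have hY' := hY.of_le hYY'
  refine (opGeomMean_le_opGeomMean_right hX hv hYY').trans ?_
  rw [opGeomMean_comm hX hY', opGeomMean_comm hX' hY']
  exact opGeomMean_le_opGeomMean_right hY' ⟨by linarith [hv.2], by linarith [hv.1]⟩ hXX'

theorem opGeomMean_rpow_neg_one (hX : IsStrictlyPositive X) (hY : IsStrictlyPositive Y) :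
    (opGeomMean v X Y) ^ (-1 : ℝ) = opGeomMean v (X ^ (-1 : ℝ)) (Y ^ (-1 : ℝ)) := by
  refine (hX.opGeomMean hY).rpow_neg_one_eq_of_mul_eq_one ?_
  set Z := X ^ (-(1 / 2) : ℝ) * Y * X ^ (-(1 / 2) : ℝ) with hZ
  have hZpos : IsStrictlyPositive Z := hX.rpow_conj hY _
  have hx1 := CFC.rpow_mul_rpow_neg (1 / 2) hX
  have hx2 := CFC.rpow_neg_mul_rpow (1 / 2) hX
  have hy1 : Y * Y ^ (-1 : ℝ) = 1 := by
    simpa [CFC.rpow_one Y hY.nonneg] using CFC.rpow_mul_rpow_neg 1 hY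
  have h1 : (X ^ (-1 : ℝ)) ^ (1 / 2 : ℝ) = X ^ (-(1 / 2) : ℝ) := by
    rw [CFC.rpow_rpow X _ _ (by norm_num) hX]; congr 1; ring
  have h2 : (X ^ (-1 : ℝ)) ^ (-(1 / 2) : ℝ) = X ^ (1 / 2 : ℝ) := by
    rw [CFC.rpow_rpow X _ _ (by norm_num) hX]; congr 1; ring
  have h3 : X ^ (1 / 2 : ℝ) * Y ^ (-1 : ℝ) * X ^ (1 / 2 : ℝ) = Z ^ (-1 : ℝ) := by
    refine (hZpos.rpow_neg_one_eq_of_mul_eq_one ?_).symm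
    calc Z * (X ^ (1 / 2 : ℝ) * Y ^ (-1 : ℝ) * X ^ (1 / 2 : ℝ))
        = X ^ (-(1 / 2) : ℝ) * Y * (X ^ (-(1 / 2) : ℝ) * X ^ (1 / 2 : ℝ)) * Y ^ (-1 : ℝ) *
            X ^ (1 / 2 : ℝ) := by simp only [hZ, mul_assoc]
      _ = X ^ (-(1 / 2) : ℝ) * (Y * Y ^ (-1 : ℝ)) * X ^ (1 / 2 : ℝ) := by
          rw [hx2, mul_one]; simp only [mul_assoc]
      _ = 1 := by rw [hy1, mul_one, hx2]
  have h4 : (Z ^ (-1 : ℝ)) ^ v = Z ^ (-v) := by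
    rw [CFC.rpow_rpow Z _ _ (by norm_num) hZpos]; congr 1; ring
  rw [opGeomMean, opGeomMean, h1, h2, h3, h4]
  calc X ^ (1 / 2 : ℝ) * Z ^ v * X ^ (1 / 2 : ℝ) *
        (X ^ (-(1 / 2) : ℝ) * Z ^ (-v) * X ^ (-(1 / 2) : ℝ))
      = X ^ (1 / 2 : ℝ) * Z ^ v * (X ^ (1 / 2 : ℝ) * X ^ (-(1 / 2) : ℝ)) * Z ^ (-v) *
          X ^ (-(1 / 2) : ℝ) := by simp only [mul_assoc]
    _ = X ^ (1 / 2 : ℝ) * (Z ^ v * Z ^ (-v)) * X ^ (-(1 / 2) : ℝ) := by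
        rw [hx1, mul_one]; simp only [mul_assoc]
    _ = 1 := by rw [CFC.rpow_mul_rpow_neg v hZpos, mul_one, hx1]

/-! ### Positive unital maps -/

theorem PositiveLinearMap.isStrictlyPositive_map (Φ : (H →L[ℂ] H) →ₚ[ℂ] (H →L[ℂ] H))
    (hΦ : Φ 1 = 1) (hX : IsStrictlyPositive X) : IsStrictlyPositive (Φ X) := by
  obtain ⟨r, hr, hrX⟩ := hX.exists_pos_algebraMap_le
  refine .of_le (isStrictlyPositive_algebraMap (𝕜 := ℝ) hr) ((?_ : _ = _).trans_le
    (OrderHomClass.mono Φ hrX))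
  rw [Algebra.algebraMap_eq_smul_one, Φ.map_smul_real, hΦ]

/-- Ando's inequality `Φ(X ♯ᵥ Y) ≤ Φ(X) ♯ᵥ Φ(Y)`. It is Jensen's inequality for `t ↦ t ^ v` and
the positive unital map `Z ↦ Φ(X)^(-1/2) Φ(X^(1/2) Z X^(1/2)) Φ(X)^(-1/2)`. -/
theorem PositiveLinearMap.map_opGeomMean_le (Φ : (H →L[ℂ] H) →ₚ[ℂ] (H →L[ℂ] H))
    (hΦ : Φ 1 = 1) (hX : IsStrictlyPositive X) (hY : IsStrictlyPositive Y)
    (hv : v ∈ Icc (0 : ℝ) 1) :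
    Φ (opGeomMean v X Y) ≤ opGeomMean v (Φ X) (Φ Y) := by
  have hΦX := Φ.isStrictlyPositive_map hΦ hX
  have hsa := (hX.rpow X (1 / 2)).isSelfAdjoint
  have hsa' := (hΦX.rpow (Φ X) (-(1 / 2))).isSelfAdjoint
  let Ψ : (H →L[ℂ] H) →ₚ[ℂ] (H →L[ℂ] H) := .mk₀
    (LinearMap.mulLeftRight ℂ (Φ X ^ (-(1 / 2) : ℝ), Φ X ^ (-(1 / 2) : ℝ)) ∘ₗ Φ.toLinearMap ∘ₗ
      LinearMap.mulLeftRight ℂ (X ^ (1 / 2 : ℝ), X ^ (1 / 2 : ℝ)))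
    fun Z hZ ↦ hsa'.conjugate_nonneg (Φ.map_nonneg (hsa.conjugate_nonneg hZ))
  have hΨ (Z : H →L[ℂ] H) : Ψ Z = Φ X ^ (-(1 / 2) : ℝ) *
    Φ (X ^ (1 / 2 : ℝ) * Z * X ^ (1 / 2 : ℝ)) * Φ X ^ (-(1 / 2) : ℝ) := rfl
  have hΨ1 : Ψ 1 = 1 := by
    rw [hΨ, mul_one, rpow_half_mul_rpow_half hX]
    exact CFC.conjugate_rpow_neg_one_half _ hΦX
  set Z := X ^ (-(1 / 2) : ℝ) * Y * X ^ (-(1 / 2) : ℝ) with hZ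
  have hZpos : IsStrictlyPositive Z := hX.rpow_conj hY _
  have hJ := (operatorMonotoneDecreasingOn_neg_rpow.{u} hv).cfc_map_le_map_cfc Ψ hΨ1 hZpos
  rw [cfc_neg_rpow_eq hZpos.nonneg, cfc_neg_rpow_eq (Ψ.map_nonneg hZpos.nonneg), map_neg,
    neg_le_neg_iff] at hJ
  have hΨZ : Ψ Z = Φ X ^ (-(1 / 2) : ℝ) * Φ Y * Φ X ^ (-(1 / 2) : ℝ) := by
    rw [hΨ, rpow_half_conj_rpow_neg_half hX]
  have hJ' := (hΦX.rpow _ (1 / 2)).isSelfAdjoint.conjugate_le_conjugate hJ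
  rw [hΨZ, hΨ, rpow_half_conj_rpow_neg_half hΦX] at hJ'
  exact hJ'

/-- Choi's inequality `Φ(X)⁻¹ ≤ Φ(X⁻¹)`. -/
theorem PositiveLinearMap.rpow_neg_one_map_le (Φ : (H →L[ℂ] H) →ₚ[ℂ] (H →L[ℂ] H))
    (hΦ : Φ 1 = 1) (hX : IsStrictlyPositive X) : Φ X ^ (-1 : ℝ) ≤ Φ (X ^ (-1 : ℝ)) := by
  have h := operatorMonotoneDecreasingOn_inv.{u}.cfc_map_le_map_cfc Φ hΦ hX
  rwa [← CFC.rpow_eq_cfc_real hX.nonneg, ← CFC.rpow_eq_cfc_real (Φ.map_nonneg hX.nonneg)] at h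

end GeomMean

/-! ### Log-convexity of operator monotone decreasing functions -/

section LogConvex

variable {H : Type u} [NormedAddCommGroup H] [InnerProductSpace ℂ H] [CompleteSpace H]
  {X Y : H →L[ℂ] H} {v : ℝ} {f : ℝ → ℝ}

theorem IsStrictlyPositive.opArithMean (hX : IsStrictlyPositive X) (hY : IsStrictlyPositive Y)
    (hv : v ∈ Icc (0 : ℝ) 1) : IsStrictlyPositive (opArithMean v X Y) :=
  (hX.opGeomMean hY).of_le (opGeomMean_le_opArithMean hX hY hv)

theorem IsStrictlyPositive.cfc_of_pos (hX : IsStrictlyPositive X) (hf : ContinuousOn f (Ioi 0))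
    (hpos : ∀ t > 0, 0 < f t) : IsStrictlyPositive (cfc f X) :=
  (cfc_isStrictlyPositive_iff f X (hf.mono hX.spectrum_subset_Ioi) hX.isSelfAdjoint).2
    fun _ hx ↦ hpos _ (hX.spectrum_pos hx)

/-- An operator monotone decreasing function on `(0, ∞)` is operator convex. -/
theorem OperatorMonotoneDecreasingOn.cfc_opArithMean_le
    (hf : OperatorMonotoneDecreasingOn.{u} (Ioi 0) f)
    (hX : IsStrictlyPositive X) (hY : IsStrictlyPositive Y) (hv : v ∈ Icc (0 : ℝ) 1) :
    cfc f (opArithMean v X Y) ≤ opArithMean v (cfc f X) (cfc f Y) := by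
  have hsq (a : ℝ) (ha : 0 ≤ a) (S : H →L[ℂ] H) :
      star (√a • (1 : H →L[ℂ] H)) * S * (√a • 1) = a • S := by
    simp [smul_smul, Real.mul_self_sqrt ha]
  have hv0 := hv.1
  have hv1 : 0 ≤ 1 - v := sub_nonneg.2 hv.2
  have hsum : ∑ i : Fin 2, star (![√(1 - v) • (1 : H →L[ℂ] H), √v • 1] i) *
      ![√(1 - v) • (1 : H →L[ℂ] H), √v • 1] i = 1 := by
    have h1 := hsq _ hv1 1
    have h2 := hsq _ hv0 1
    rw [mul_one] at h1 h2
    simp only [Fin.sum_univ_two, Matrix.cons_val_zero, Matrix.cons_val_one, h1, h2]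
    rw [← add_smul, sub_add_cancel, one_smul]
  have key := hf.cfc_sum_conj_le hsum (A := ![X, Y]) (by simp [Fin.forall_fin_two, hX, hY])
  simpa only [opArithMean, Fin.sum_univ_two, Matrix.cons_val_zero, Matrix.cons_val_one,
    hsq _ hv1, hsq _ hv0] using key

/-- Operator log-convexity (Ando–Hiai). As `1 / f` is operator concave,
`f(X)⁻¹ ♯ᵥ f(Y)⁻¹ ≤ f(X)⁻¹ ∇ᵥ f(Y)⁻¹ ≤ f(X ∇ᵥ Y)⁻¹`; now take inverses. -/
theorem OperatorMonotoneDecreasingOn.cfc_opArithMean_le_opGeomMean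
    (hf : OperatorMonotoneDecreasingOn.{u} (Ioi 0) f) (hpos : ∀ t > 0, 0 < f t)
    (hX : IsStrictlyPositive X) (hY : IsStrictlyPositive Y) (hv : v ∈ Icc (0 : ℝ) 1) :
    cfc f (opArithMean v X Y) ≤ opGeomMean v (cfc f X) (cfc f Y) := by
  have hXY := hX.opArithMean hY hv
  have hneg {Z : H →L[ℂ] H} (hZ : IsStrictlyPositive Z) :
      cfc (fun t ↦ -(f t)⁻¹) Z = -(cfc f Z) ^ (-1 : ℝ) :=
    cfc_neg_inv_eq hZ.isSelfAdjoint (hf.1.mono hZ.spectrum_subset_Ioi)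
      fun x hx ↦ hpos x (hZ.spectrum_pos hx)
  have hfX := hX.cfc_of_pos hf.1 hpos
  have hfY := hY.cfc_of_pos hf.1 hpos
  have hfXY := hXY.cfc_of_pos hf.1 hpos
  have hconc := (hf.neg_inv hpos).cfc_opArithMean_le hX hY hv
  have hconc' : opArithMean v (cfc f X ^ (-1 : ℝ)) (cfc f Y ^ (-1 : ℝ)) ≤
      cfc f (opArithMean v X Y) ^ (-1 : ℝ) := by
    rw [hneg hX, hneg hY, hneg hXY] at hconc
    rw [← neg_le_neg_iff]
    simpa only [opArithMean, smul_neg, neg_add] using hconc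
  have h := CStarAlgebra.rpow_neg_one_le_rpow_neg_one
    ((opGeomMean_le_opArithMean (hfX.rpow _ _) (hfY.rpow _ _) hv).trans hconc')
    ((hfX.rpow _ _).opGeomMean (hfY.rpow _ _))
  rwa [opGeomMean_rpow_neg_one (hfX.rpow _ _) (hfY.rpow _ _), hfX.rpow_neg_one_rpow_neg_one,
    hfY.rpow_neg_one_rpow_neg_one, hfXY.rpow_neg_one_rpow_neg_one] at h

/-- The comparison of the two geometric means. Applying Jensen's inequality to `f` and then Ando's
inequality would leave both sides below `Φ(f(X)) ♯ᵥ Φ(f(Y))`; passing to `1 / f`, which reverses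
Jensen's inequality, and returning by Choi's inequality makes the estimates compose. -/
theorem OperatorMonotoneDecreasingOn.opGeomMean_cfc_map_le
    (hf : OperatorMonotoneDecreasingOn.{u} (Ioi 0) f) (hpos : ∀ t > 0, 0 < f t)
    (Φ : (H →L[ℂ] H) →ₚ[ℂ] (H →L[ℂ] H)) (hΦ : Φ 1 = 1)
    (hX : IsStrictlyPositive X) (hY : IsStrictlyPositive Y) (hv : v ∈ Icc (0 : ℝ) 1) :
    opGeomMean v (cfc f (Φ X)) (cfc f (Φ Y)) ≤ Φ (opGeomMean v (cfc f X) (cfc f Y)) := by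
  have hneg {Z : H →L[ℂ] H} (hZ : IsStrictlyPositive Z) :
      cfc (fun t ↦ -(f t)⁻¹) Z = -(cfc f Z) ^ (-1 : ℝ) :=
    cfc_neg_inv_eq hZ.isSelfAdjoint (hf.1.mono hZ.spectrum_subset_Ioi)
      fun x hx ↦ hpos x (hZ.spectrum_pos hx)
  have hjensen {Z : H →L[ℂ] H} (hZ : IsStrictlyPositive Z) :
      Φ (cfc f Z ^ (-1 : ℝ)) ≤ cfc f (Φ Z) ^ (-1 : ℝ) := by
    have := (hf.neg_inv hpos).cfc_map_le_map_cfc Φ hΦ hZ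
    rwa [hneg hZ, hneg (Φ.isStrictlyPositive_map hΦ hZ), map_neg, neg_le_neg_iff] at this
  have hfX := hX.cfc_of_pos hf.1 hpos
  have hfY := hY.cfc_of_pos hf.1 hpos
  have hfΦX := (Φ.isStrictlyPositive_map hΦ hX).cfc_of_pos hf.1 hpos
  have hfΦY := (Φ.isStrictlyPositive_map hΦ hY).cfc_of_pos hf.1 hpos
  set F := cfc f X ^ (-1 : ℝ) with hF
  set G := cfc f Y ^ (-1 : ℝ) with hG
  have hFpos : IsStrictlyPositive F := hfX.rpow _ _
  have hGpos : IsStrictlyPositive G := hfY.rpow _ _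
  have hFG : IsStrictlyPositive (opGeomMean v F G) := hFpos.opGeomMean hGpos
  calc opGeomMean v (cfc f (Φ X)) (cfc f (Φ Y))
      = opGeomMean v (cfc f (Φ X) ^ (-1 : ℝ)) (cfc f (Φ Y) ^ (-1 : ℝ)) ^ (-1 : ℝ) := by
        rw [opGeomMean_rpow_neg_one (hfΦX.rpow _ _) (hfΦY.rpow _ _),
          hfΦX.rpow_neg_one_rpow_neg_one, hfΦY.rpow_neg_one_rpow_neg_one]
    _ ≤ opGeomMean v (Φ F) (Φ G) ^ (-1 : ℝ) :=
        CStarAlgebra.rpow_neg_one_le_rpow_neg_one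
          (opGeomMean_mono (Φ.isStrictlyPositive_map hΦ hFpos) (Φ.isStrictlyPositive_map hΦ hGpos)
            hv (hjensen hX) (hjensen hY))
          ((Φ.isStrictlyPositive_map hΦ hFpos).opGeomMean (Φ.isStrictlyPositive_map hΦ hGpos))
    _ ≤ Φ (opGeomMean v F G) ^ (-1 : ℝ) :=
        CStarAlgebra.rpow_neg_one_le_rpow_neg_one (Φ.map_opGeomMean_le hΦ hFpos hGpos hv)
          (Φ.isStrictlyPositive_map hΦ hFG)
    _ ≤ Φ (opGeomMean v F G ^ (-1 : ℝ)) := Φ.rpow_neg_one_map_le hΦ hFG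
    _ = Φ (opGeomMean v (cfc f X) (cfc f Y)) := by
        rw [opGeomMean_rpow_neg_one hFpos hGpos, hfX.rpow_neg_one_rpow_neg_one,
          hfY.rpow_neg_one_rpow_neg_one]

theorem PositiveLinearMap.map_opArithMean (Φ : (H →L[ℂ] H) →ₚ[ℂ] (H →L[ℂ] H)) :
    Φ (opArithMean v X Y) = opArithMean v (Φ X) (Φ Y) := by
  simp only [opArithMean, map_add, Φ.map_smul_real]

end LogConvex

theorem lemma3p3 {H : Type u} [NormedAddCommGroup H] [InnerProductSpace ℂ H] [CompleteSpace H]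
    (A B : H →L[ℂ] H) (hA : IsStrictlyPositive A) (hB : IsStrictlyPositive B)
    (Φ : (H →L[ℂ] H) →ₚ[ℂ] (H →L[ℂ] H)) (hΦ : Φ 1 = 1)
    (f : ℝ → ℝ) (hf : OperatorMonotoneDecreasingOn.{u} (Ioi 0) f) (hfpos : ∀ t > 0, 0 < f t)
    (v : ℝ) (hv : v ∈ Icc (0 : ℝ) 1) :
    (cfc f (Φ (opArithMean v A B)) ≤ opGeomMean v (cfc f (Φ A)) (cfc f (Φ B)) ∧
      opGeomMean v (cfc f (Φ A)) (cfc f (Φ B)) ≤ opArithMean v (Φ (cfc f A)) (Φ (cfc f B))) ∧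
    (cfc f (Φ (opArithMean v A B)) ≤ Φ (opGeomMean v (cfc f A) (cfc f B)) ∧
      Φ (opGeomMean v (cfc f A) (cfc f B)) ≤ opArithMean v (Φ (cfc f A)) (Φ (cfc f B))) ∧
    (cfc f (Φ (opArithMean v A B)) ≤ opGeomMean v (cfc f (Φ A)) (cfc f (Φ B)) ∧
      opGeomMean v (cfc f (Φ A)) (cfc f (Φ B)) ≤ Φ (opGeomMean v (cfc f A) (cfc f B)) ∧
      Φ (opGeomMean v (cfc f A) (cfc f B)) ≤ opArithMean v (Φ (cfc f A)) (Φ (cfc f B))) := by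
  have h1 : cfc f (Φ (opArithMean v A B)) ≤ opGeomMean v (cfc f (Φ A)) (cfc f (Φ B)) := by
    rw [Φ.map_opArithMean]
    exact hf.cfc_opArithMean_le_opGeomMean hfpos (Φ.isStrictlyPositive_map hΦ hA)
      (Φ.isStrictlyPositive_map hΦ hB) hv
  have h2 := hf.opGeomMean_cfc_map_le hfpos Φ hΦ hA hB hv
  have h3 : Φ (opGeomMean v (cfc f A) (cfc f B)) ≤ opArithMean v (Φ (cfc f A)) (Φ (cfc f B)) := by
    rw [← Φ.map_opArithMean]
    exact OrderHomClass.mono Φ (opGeomMean_le_opArithMean (hA.cfc_of_pos hf.1 hfpos)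
      (hB.cfc_of_pos hf.1 hfpos) hv)
  exact ⟨⟨h1, h2.trans h3⟩, ⟨h1.trans h2, h3⟩, h1, h2, h3⟩
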